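/- Let $U$ be a finite-dimensional complex vector space, let $p\colon GL(U)\to PGL(U)$ be the canonical projection, and let $(\overline G,\overline H)$ be a reductive dual pair in $PGL(U)$; that is, $\overline G$ and $\overline H$ are reductive (not necessarily connected) algebraic subgroups of $PGL(U)$ with $Z_{PGL(U)}(\overline G)=\overline H$ and $Z_{PGL(U)}(\overline H)=\overline G$, where $Z$ denotes the centralizer. Put $G:=p^{-1}(\overline G)$ and $H:=p^{-1}(\overline H)$, and let $G^\circ$, $H^\circ$ be their identity components as algebraic groups. Then $$G^\circ = Z_{GL(U)}(H)=\prod_i GL(B_i)\qquad\text{and}\qquad H^\circ = Z_{GL(U)}(G)=\prod_j GL(E_j)$$ for some finite families $(B_i),(A_i)$ and $(E_j),(F_j)$ of nonzero finite-dimensional complex vector spaces with $$U\simeq\bigoplus_i B_i\otimes A_i\simeq\bigoplus_j E_j\otimes F_j .$$ Here $\prod_i GL(B_i)$ is regarded as a subgroup of $GL(U)$ by letting $(b_i)_i$ act on $\bigoplus_i B_i\otimes A_i$ as $\bigoplus_i b_i\otimes \mathrm{id}_{A_i}$, and likewise $(e_j)_j\in\prod_j GL(E_j)$ acts as $\bigoplus_j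 e_j\otimes\mathrm{id}_{F_j}$. -/

import Mathlib

open scoped TensorProduct DirectSum Topology

noncomputable section

namespace DualPair

universe u

variable (U : Type u) [AddCommGroup U] [Module ℂ U]

/-- `GL(U)`. -/
abbrev GLin : Type u := LinearMap.GeneralLinearGroup ℂ U

/-- `PGL(U)`, the quotient of `GL(U)` by its centre (the scalars). -/
abbrev PGLin : Type u := GLin U ⧸ Subgroup.center (GLin U)

/-- The canonical projection `p : GL(U) → PGL(U)`. -/
abbrev proj : GLin U →* PGLin U := QuotientGroup.mk' (Subgroup.center (GLin U))

/-- The polynomial functions on a finite-dimensional complex vector space: the algebra of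
functions generated by the linear functionals. -/
def polynomialFunctions (V : Type u) [AddCommGroup V] [Module ℂ V] : Subalgebra ℂ (V → ℂ) :=
  Algebra.adjoin ℂ (Set.range fun φ : Module.Dual ℂ V => (φ : V → ℂ))

/-- The Zariski topology on `GL(U)`, a principal open subset of the affine space `End(U)`: the
sets `{g | f g ≠ 0}`, for `f` a polynomial function on `End(U)`, form a basis. -/
@[reducible] def zariskiGL : TopologicalSpace (GLin U) :=
  TopologicalSpace.generateFrom
    {s | ∃ f ∈ polynomialFunctions (Module.End ℂ U), s = {g : GLin U | f (g : Module.End ℂ U) ≠ 0}}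

/-- The Zariski topology on `PGL(U)`, the geometric quotient of `GL(U)` by its centre: a set is
open if and only if its preimage in `GL(U)` is. -/
@[reducible] def zariskiPGL : TopologicalSpace (PGLin U) :=
  TopologicalSpace.coinduced (proj U) (zariskiGL U)

variable {U}

/-- An element of `PGL(U)` is unipotent if it is the image of a unipotent element of `GL(U)`.
(By Jordan decomposition, this is unipotence in the linear algebraic group `PGL(U)`.) -/
def IsUnipotent (x : PGLin U) : Prop :=
  ∃ g : GLin U, IsNilpotent ((g : Module.End ℂ U) - 1) ∧ proj U g = x

/-- A subgroup of `PGL(U)` is algebraic if it is Zariski closed. -/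
def IsAlgebraic (K : Subgroup (PGLin U)) : Prop :=
  IsClosed[zariskiPGL U] (K : Set (PGLin U))

/-- An algebraic subgroup `K` of `PGL(U)` (not necessarily connected) is reductive if its
unipotent radical is trivial: the only Zariski closed connected normal subgroup of `K` that
consists of unipotent elements is the trivial one. -/
def IsReductive (K : Subgroup (PGLin U)) : Prop :=
  IsAlgebraic K ∧
    ∀ N : Subgroup (PGLin U), N ≤ K → (N.subgroupOf K).Normal → IsAlgebraic N →
      @IsConnected (PGLin U) (zariskiPGL U) (N : Set (PGLin U)) → (∀ x ∈ N, IsUnipotent x) → N = ⊥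

/-- Reductive dual pairs in `PGL(U)`. -/
structure IsReductiveDualPair (K L : Subgroup (PGLin U)) : Prop where
  reductive_left : IsReductive K
  reductive_right : IsReductive L
  centralizer_left : Subgroup.centralizer (K : Set (PGLin U)) = L
  centralizer_right : Subgroup.centralizer (L : Set (PGLin U)) = K

/-- The identity component of a subgroup `G` of `GL(U)`, as a subset of `GL(U)`: the connected
component of `1` in `G`, for the subspace topology of the Zariski topology. -/
def identityComponent (G : Subgroup (GLin U)) : Set (GLin U) :=
  @connectedComponentIn (GLin U) (zariskiGL U) (G : Set (GLin U)) 1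

variable (U) in
/-- A decomposition `U ≃ ⨁ i, B i ⊗ A i` into finitely many tensor products of nonzero
finite-dimensional complex vector spaces. -/
structure TensorDecomposition where
  r : ℕ
  B : Fin r → Type u
  A : Fin r → Type u
  [addCommGroupB : ∀ i, AddCommGroup (B i)]
  [moduleB : ∀ i, Module ℂ (B i)]
  [finiteB : ∀ i, FiniteDimensional ℂ (B i)]
  [nontrivialB : ∀ i, Nontrivial (B i)]
  [addCommGroupA : ∀ i, AddCommGroup (A i)]
  [moduleA : ∀ i, Module ℂ (A i)]
  [finiteA : ∀ i, FiniteDimensional ℂ (A i)]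
  [nontrivialA : ∀ i, Nontrivial (A i)]
  equiv : U ≃ₗ[ℂ] ⨁ i, B i ⊗[ℂ] A i

namespace TensorDecomposition

attribute [instance] addCommGroupB moduleB finiteB nontrivialB addCommGroupA moduleA finiteA
  nontrivialA

/-- `∏ i, End(B i)` acting on `U` through the decomposition: the family `b` acts on the summand
`B i ⊗ A i` as `b i ⊗ id`. -/
def endHom (D : TensorDecomposition U) : (∀ i, Module.End ℂ (D.B i)) →* Module.End ℂ U where
  toFun b := D.equiv.symm.toLinearMap ∘ₗ
    DirectSum.lmap (fun i => LinearMap.rTensor (D.A i) (b i)) ∘ₗ D.equiv.toLinearMap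
  map_one' := by
    have h : (fun i => LinearMap.rTensor (D.A i) ((1 : ∀ i, Module.End ℂ (D.B i)) i)) =
        fun i => LinearMap.id := by
      funext i
      exact LinearMap.rTensor_id _ _
    rw [h, DirectSum.lmap_id]
    ext x
    simp
  map_mul' b c := by
    have h : (fun i => LinearMap.rTensor (D.A i) ((b * c) i)) =
        fun i => LinearMap.rTensor (D.A i) (b i) ∘ₗ LinearMap.rTensor (D.A i) (c i) := by
      funext i
      exact LinearMap.rTensor_mul _ _ _
    rw [h, DirectSum.lmap_comp]
    ext x
    simp

/-- The embedding `∏ i, GL(B i) → GL(U)`, where `(b i)` acts on `B i ⊗ A i` as `b i ⊗ id`. -/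
def glHom (D : TensorDecomposition U) : (∀ i, GLin (D.B i)) →* GLin U :=
  (Units.map D.endHom).comp MulEquiv.piUnits.symm.toMonoidHom

end TensorDecomposition

end DualPair

end

/-! Lifts of commuting elements of `PGL(U)` commute up to a scalar, and taking determinants shows
that the scalar is an `n`-th root of unity, `n = dim U`. So for `h ∈ H` and `n > 0`, `G` is covered
by the finitely many closed sets `g h = c h g`, which are pairwise disjoint; the identity component
stays in the one with `c = 1`, whence `G° ⊆ Z(H)`. Conversely `Z(H) ⊆ G` is the unit group of the
commutant algebra of `H`, a principal open subset of a linear space, hence irreducible. This is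
`identityComponent_eq_centralizer`; it does not use reductivity.

Reductivity makes the commutant semisimple (`isSemisimpleRing_commutant`). Conjugation by `G`
preserves the commutant and hence its Jacobson radical `J`, so `1 + J` has a closed connected normal
unipotent image in `PGL(U)`. The image is trivial, so `1 + J` consists of scalars; a nilpotent
scalar vanishes, and `J = 0`. By Wedderburn–Artin the commutant is a product of matrix algebras,
whose matrix units split `U` into the blocks `B i ⊗ A i`; its units are `∏ GL(B i)`. The other half
follows by symmetry. -/

noncomputable section

namespace DualPair

universe u

variable {U : Type u} [AddCommGroup U] [Module ℂ U]

/-! ### Closed and irreducible sets in the Zariski topology of `GL(U)`. -/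

section Zariski

theorem isTopologicalBasis_zariskiGL :
    @TopologicalSpace.IsTopologicalBasis (GLin U) (zariskiGL U)
      {s | ∃ f ∈ polynomialFunctions (Module.End ℂ U),
        s = {g : GLin U | f (g : Module.End ℂ U) ≠ 0}} := by
  let := zariskiGL U
  refine ⟨?_, ?_, rfl⟩
  · rintro _ ⟨f, hf, rfl⟩ _ ⟨f', hf', rfl⟩ x hx
    refine ⟨_, ⟨f * f', mul_mem hf hf', rfl⟩, ?_, ?_⟩
    · exact mul_ne_zero hx.1 hx.2
    · exact fun g hg => ⟨left_ne_zero_of_mul hg, right_ne_zero_of_mul hg⟩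
  · refine Set.eq_univ_of_forall fun x => ⟨_, ⟨1, one_mem _, rfl⟩, ?_⟩
    simp

theorem isClosed_zero_locus {f : Module.End ℂ U → ℂ}
    (hf : f ∈ polynomialFunctions (Module.End ℂ U)) :
    IsClosed[zariskiGL U] {g : GLin U | f (g : Module.End ℂ U) = 0} := by
  let := zariskiGL U
  exact ⟨TopologicalSpace.isOpen_generateFrom_of_mem ⟨f, hf, rfl⟩⟩

/-- A subspace is cut out by the linear functionals that vanish on it. -/
theorem isClosed_mem_submodule (S : Submodule ℂ (Module.End ℂ U)) :
    IsClosed[zariskiGL U] {g : GLin U | (g : Module.End ℂ U) ∈ S} := by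
  let := zariskiGL U
  have h : {g : GLin U | (g : Module.End ℂ U) ∈ S} =
      ⋂ φ ∈ S.dualAnnihilator, {g : GLin U | φ (g : Module.End ℂ U) = 0} := by
    ext g
    simp only [Set.mem_ofPred_eq, Set.mem_iInter, Submodule.mem_dualAnnihilator]
    refine ⟨fun hg φ hφ => hφ _ hg, fun hg => ?_⟩
    by_contra hgS
    obtain ⟨φ, hφ, hS⟩ := Submodule.exists_le_ker_of_notMem hgS
    exact hφ (hg φ fun w hw => hS hw)
  rw [h]
  exact isClosed_biInter fun φ _ => isClosed_zero_locus (Algebra.subset_adjoin ⟨φ, rfl⟩)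

theorem exists_polynomial_eval_line {V : Type u} [AddCommGroup V] [Module ℂ V] {f : V → ℂ}
    (hf : f ∈ polynomialFunctions V) (a b : V) :
    ∃ P : Polynomial ℂ, ∀ t : ℂ, f (a + t • b) = P.eval t := by
  induction hf using Algebra.adjoin_induction with
  | mem f hf =>
    obtain ⟨φ, rfl⟩ := hf
    exact ⟨Polynomial.C (φ a) + Polynomial.C (φ b) * Polynomial.X, fun t => by simp [mul_comm t]⟩
  | algebraMap r => exact ⟨Polynomial.C r, fun t => by simp⟩
  | add f g _ _ ihf ihg =>
    obtain ⟨P, hP⟩ := ihf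
    obtain ⟨Q, hQ⟩ := ihg
    exact ⟨P + Q, fun t => by simp [hP, hQ]⟩
  | mul f g _ _ ihf ihg =>
    obtain ⟨P, hP⟩ := ihf
    obtain ⟨Q, hQ⟩ := ihg
    exact ⟨P * Q, fun t => by simp [hP, hQ]⟩

theorem det_mem_polynomialFunctions [FiniteDimensional ℂ U] :
    (fun f : Module.End ℂ U => LinearMap.det f) ∈ polynomialFunctions (Module.End ℂ U) := by
  let b := Module.finBasis ℂ U
  have h : (fun f : Module.End ℂ U => LinearMap.det f) =
      ∑ σ : Equiv.Perm (Fin (Module.finrank ℂ U)), ((Equiv.Perm.sign σ : ℤ) : ℂ) •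
        ∏ i, fun f : Module.End ℂ U => LinearMap.toMatrix b b f (σ i) i := by
    funext f
    rw [← LinearMap.det_toMatrix b, Matrix.det_apply']
    simp
  rw [h]
  refine Subalgebra.sum_mem _ fun σ _ =>
    Subalgebra.smul_mem _ (Subalgebra.prod_mem _ fun i _ => ?_) _
  exact Algebra.subset_adjoin
    ⟨Matrix.entryLinearMap ℂ ℂ (σ i) i ∘ₗ (LinearMap.toMatrix b b).toLinearMap, rfl⟩

/-- The invertible elements of a set of endomorphisms that contains the line through any two of
its points form an irreducible set in the Zariski topology. -/
theorem isPreconnected_of_line_mem [FiniteDimensional ℂ U] (W : Set (Module.End ℂ U))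
    (hW : ∀ a ∈ W, ∀ b ∈ W, ∀ t : ℂ, a + t • (b - a) ∈ W) :
    @IsPreconnected (GLin U) (zariskiGL U) {g : GLin U | (g : Module.End ℂ U) ∈ W} := by
  let := zariskiGL U
  refine IsPreirreducible.isPreconnected ?_
  rintro u v hu hv ⟨x, hxW, hxu⟩ ⟨y, hyW, hyv⟩
  obtain ⟨_, ⟨f, hf, rfl⟩, hxf, hfu⟩ := isTopologicalBasis_zariskiGL.exists_subset_of_mem_open hxu hu
  obtain ⟨_, ⟨f', hf', rfl⟩, hyf, hfv⟩ :=
    isTopologicalBasis_zariskiGL.exists_subset_of_mem_open hyv hv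
  obtain ⟨P, hP⟩ := exists_polynomial_eval_line hf x (y - x : Module.End ℂ U)
  obtain ⟨Q, hQ⟩ := exists_polynomial_eval_line hf' x (y - x : Module.End ℂ U)
  obtain ⟨R, hR⟩ := exists_polynomial_eval_line det_mem_polynomialFunctions (x : Module.End ℂ U)
    (y - x : Module.End ℂ U)
  -- On the line from `x` to `y`, `f` and `det` are nonzero at `t = 0`, and `f'` at `t = 1`. Since
  -- `ℂ` is infinite, some `t` avoids the roots of all three.
  have hP0 : P ≠ 0 := by
    rintro rfl
    exact hxf (by simpa using hP 0)
  have hQ0 : Q ≠ 0 := by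
    rintro rfl
    exact hyf (by simpa using hQ 1)
  have hR0 : R ≠ 0 := by
    rintro rfl
    exact (LinearMap.isUnit_det _ x.isUnit).ne_zero (by simpa using hR 0)
  obtain ⟨t, ht⟩ := Polynomial.exists_eval_ne_zero_of_natDegree_lt_card (P * Q * R)
    (by simp [hP0, hQ0, hR0]) ((Cardinal.natCast_lt_aleph0).trans_le (Cardinal.aleph0_le_mk ℂ))
  simp only [Polynomial.eval_mul, ← hP, ← hQ, ← hR] at ht
  obtain ⟨g, hg⟩ := (LinearMap.isUnit_iff_isUnit_det _).2 (right_ne_zero_of_mul ht).isUnit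
  rw [← hg] at ht
  exact ⟨g, by simpa [hg] using hW _ hxW _ hyW t, hfu (left_ne_zero_of_mul (left_ne_zero_of_mul ht)),
    hfv (right_ne_zero_of_mul (left_ne_zero_of_mul ht))⟩

end Zariski

/-! ### Scalars and commutation in `PGL(U)`. -/

section Center

theorem exists_eq_smul_one_of_mem_center [FiniteDimensional ℂ U] {z : GLin U} (hz : z ∈ Subgroup.center (GLin U)) :
    ∃ c : ℂ, (z : Module.End ℂ U) = c • 1 := by
  have h : (z : Module.End ℂ U) ∈ Subalgebra.center ℂ (Module.End ℂ U) := by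
    rw [Subalgebra.mem_center_iff]
    intro f
    -- The spectrum is finite, so every endomorphism is a scalar minus an invertible one; commuting
    -- with `GL(U)` implies commuting with `End(U)`.
    obtain ⟨μ, hμ⟩ := (Module.End.finite_spectrum f).exists_notMem
    obtain ⟨g, hg⟩ := spectrum.notMem_iff.1 hμ
    have hf : f = algebraMap ℂ _ μ - g := by rw [hg]; abel
    have hgz : (g : Module.End ℂ U) * z = z * g := congrArg Units.val (Subgroup.mem_center_iff.1 hz g)
    rw [hf, sub_mul, mul_sub, hgz, Algebra.commutes]
  rw [Algebra.IsCentral.center_eq_bot, Algebra.mem_bot] at h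
  obtain ⟨c, hc⟩ := h
  exact ⟨c, by rw [← hc, Algebra.algebraMap_eq_smul_one]⟩

theorem mem_center_of_eq_smul_one {z : GLin U} {c : ℂ} (hz : (z : Module.End ℂ U) = c • 1) :
    z ∈ Subgroup.center (GLin U) := by
  rw [Subgroup.mem_center_iff]
  intro g
  ext1
  simp [hz]

/-- Elements with commuting images in `PGL(U)` commute up to a root of unity. -/
theorem exists_mul_eq_smul_mul [FiniteDimensional ℂ U] {g h : GLin U} (hgh : Commute (proj U g) (proj U h)) :
    ∃ c : ℂ, c ^ Module.finrank ℂ U = 1 ∧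
      (g : Module.End ℂ U) * h = c • ((h : Module.End ℂ U) * g) := by
  have hz : (h * g)⁻¹ * (g * h) ∈ Subgroup.center (GLin U) := by
    rw [← QuotientGroup.eq]
    exact hgh.eq.symm
  obtain ⟨c, hc⟩ := exists_eq_smul_one_of_mem_center hz
  have h1 : (g : Module.End ℂ U) * h = c • ((h : Module.End ℂ U) * g) := by
    have := congrArg (((h * g : GLin U) : Module.End ℂ U) * ·) hc
    simpa [← Units.val_mul, mul_assoc] using this
  refine ⟨c, ?_, h1⟩
  have h2 := congrArg LinearMap.det h1
  rw [LinearMap.det_smul, map_mul, map_mul, mul_comm (LinearMap.det (h : Module.End ℂ U))] at h2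
  exact (mul_eq_right₀ (mul_ne_zero (LinearMap.isUnit_det _ g.isUnit).ne_zero
    (LinearMap.isUnit_det _ h.isUnit).ne_zero)).1 h2.symm

end Center

/-! ### Matrix units in a product of matrix algebras. -/

section MatrixUnits

variable {r : ℕ} {d : Fin r → ℕ}

/-- The matrix unit of the block `i` at the position `(k, l)`. -/
def matrixUnit (i : Fin r) (k l : Fin (d i)) : ∀ i, Matrix (Fin (d i)) (Fin (d i)) ℂ :=
  Pi.single i (Matrix.single k l 1)

theorem matrixUnit_mul_same (i : Fin r) (k l m : Fin (d i)) :
    matrixUnit i k l * matrixUnit i l m = matrixUnit i k m := by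
  simp [matrixUnit, ← Pi.single_mul]

theorem matrixUnit_mul_of_ne (i : Fin r) (k l l' m : Fin (d i)) (h : l ≠ l') :
    matrixUnit i k l * matrixUnit i l' m = 0 := by
  simp [matrixUnit, ← Pi.single_mul, h]

theorem matrixUnit_mul_of_ne_block {i j : Fin r} (h : i ≠ j) (k l : Fin (d i))
    (k' l' : Fin (d j)) : matrixUnit i k l * matrixUnit j k' l' = 0 := by
  funext m
  by_cases hm : m = i
  · subst hm
    simp [matrixUnit, Pi.single_eq_of_ne h]
  · simp [matrixUnit, Pi.single_eq_of_ne hm]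

theorem mul_matrixUnit (M : ∀ i, Matrix (Fin (d i)) (Fin (d i)) ℂ) (i : Fin r)
    (k m : Fin (d i)) : M * matrixUnit i k m = ∑ l, M i l k • matrixUnit i l m := by
  have h : M * matrixUnit i k m = Pi.single i (M i * Matrix.single k m 1) := by
    funext j
    by_cases hj : j = i
    · subst hj
      simp [matrixUnit]
    · simp [matrixUnit, Pi.single_eq_of_ne hj]
  have h2 : M i * Matrix.single k m 1 = ∑ l, M i l k • Matrix.single l m (1 : ℂ) := by
    ext a b
    simp [Matrix.sum_apply, Matrix.mul_apply, Matrix.single_apply, ite_and]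
  rw [h, h2]
  simp only [matrixUnit, ← Pi.single_smul]
  exact map_sum (AddMonoidHom.single (fun i => Matrix (Fin (d i)) (Fin (d i)) ℂ) i) _ _

theorem sum_matrixUnit :
    ∑ i, ∑ k, matrixUnit i k k = (1 : ∀ i, Matrix (Fin (d i)) (Fin (d i)) ℂ) := by
  have h (i : Fin r) : ∑ k, matrixUnit i k k =
      (Pi.single i 1 : ∀ i, Matrix (Fin (d i)) (Fin (d i)) ℂ) := by
    rw [← Matrix.sum_single_one]
    exact (map_sum (AddMonoidHom.single (fun i => Matrix (Fin (d i)) (Fin (d i)) ℂ) i) _ _).symm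
  simp_rw [h]
  exact Finset.univ_sum_single (1 : ∀ i, Matrix (Fin (d i)) (Fin (d i)) ℂ)

end MatrixUnits

/-! ### From an action of a product of matrix algebras to a tensor decomposition. -/

section Decomposition

variable {r : ℕ} {d : Fin r → ℕ} [∀ i, NeZero (d i)]
  (φ : (∀ i, Matrix (Fin (d i)) (Fin (d i)) ℂ) →ₐ[ℂ] Module.End ℂ U)

/-- The multiplicity space of the block `i`: the image of its first diagonal matrix unit. -/
abbrev multiplicitySpace (i : Fin r) : Submodule ℂ U := LinearMap.range (φ (matrixUnit i 0 0))

theorem apply_matrixUnit_zero {i : Fin r} (a : multiplicitySpace φ i) :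
    φ (matrixUnit i 0 0) a = a := by
  obtain ⟨_, x, rfl⟩ := a
  change (φ _ * φ _) x = _
  rw [← map_mul, matrixUnit_mul_same]

theorem apply_matrixUnit_mem (i : Fin r) (k : Fin (d i)) (x : U) :
    φ (matrixUnit i 0 k) x ∈ multiplicitySpace φ i := by
  refine ⟨φ (matrixUnit i 0 k) x, ?_⟩
  change (φ _ * φ _) x = _
  rw [← map_mul, matrixUnit_mul_same]

/-- The standard representation space of the block `i`, in the universe of `U`. -/
abbrev standardSpace (d : Fin r → ℕ) (i : Fin r) : Type u := ULift.{u} (Fin (d i) → ℂ)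

/-- The map `B i ⊗ A i → U`, `b ⊗ a ↦ ∑ k, b k • e k 0 a`. -/
def blockMap (i : Fin r) : standardSpace.{u} d i ⊗[ℂ] multiplicitySpace φ i →ₗ[ℂ] U :=
  TensorProduct.lift (LinearMap.mk₂ ℂ
    (fun b a => ∑ k, b.down k • φ (matrixUnit i k 0) (a : U))
    (fun b b' a => by simp [add_smul, Finset.sum_add_distrib])
    (fun c b a => by simp [Finset.smul_sum, mul_smul])
    (fun b a a' => by simp [Finset.sum_add_distrib])
    (fun c b a => by simp [Finset.smul_sum, smul_comm c]))

theorem blockMap_tmul (i : Fin r) (b : standardSpace.{u} d i) (a : multiplicitySpace φ i) :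
    blockMap φ i (b ⊗ₜ a) = ∑ k, b.down k • φ (matrixUnit i k 0) (a : U) := rfl

/-- The map `U → B i ⊗ A i`, `x ↦ ∑ k, δ k ⊗ e 0 k x`. -/
def blockCoord (i : Fin r) : U →ₗ[ℂ] standardSpace.{u} d i ⊗[ℂ] multiplicitySpace φ i :=
  ∑ k, TensorProduct.mk ℂ _ _ (ULift.up (Pi.single k 1)) ∘ₗ
    (φ (matrixUnit i 0 k)).codRestrict _ (apply_matrixUnit_mem φ i k)

theorem blockCoord_apply (i : Fin r) (x : U) :
    blockCoord φ i x = ∑ k, (ULift.up (Pi.single k 1) : standardSpace.{u} d i) ⊗ₜ[ℂ]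
      (⟨φ (matrixUnit i 0 k) x, apply_matrixUnit_mem φ i k x⟩ : multiplicitySpace φ i) := by
  simp [blockCoord, LinearMap.sum_apply]
  rfl

/-- Comes from `e k 0 * e 0 k = e k k`. Summed over the blocks, these idempotents give the identity,
so the maps of all blocks together are mutually inverse. -/
theorem blockMap_blockCoord (i : Fin r) (x : U) :
    blockMap φ i (blockCoord φ i x) = ∑ k, φ (matrixUnit i k k) x := by
  rw [blockCoord_apply, map_sum]
  refine Finset.sum_congr rfl fun k _ => ?_
  rw [blockMap_tmul, Finset.sum_eq_single k]
  · simp only [Pi.single_eq_same, one_smul]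
    change (φ _ * φ _) x = _
    rw [← map_mul, matrixUnit_mul_same]
  · intro l _ hl
    simp [hl]
  · simp

theorem blockCoord_blockMap_same (i : Fin r)
    (y : standardSpace.{u} d i ⊗[ℂ] multiplicitySpace φ i) :
    blockCoord φ i (blockMap φ i y) = y := by
  induction y with
  | zero => simp
  | add y z hy hz => rw [map_add, map_add, hy, hz]
  | tmul b a =>
    have h (k : Fin (d i)) : (⟨φ (matrixUnit i 0 k) (blockMap φ i (b ⊗ₜ a)),
        apply_matrixUnit_mem φ i k _⟩ : multiplicitySpace φ i) = b.down k • a := by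
      ext
      simp only [blockMap_tmul, map_sum, map_smul, Submodule.coe_smul]
      rw [Finset.sum_eq_single k]
      · change _ • (φ _ * φ _) (a : U) = _
        rw [← map_mul, matrixUnit_mul_same, apply_matrixUnit_zero]
      · intro l _ hl
        change _ • (φ _ * φ _) (a : U) = _
        rw [← map_mul, matrixUnit_mul_of_ne _ _ _ _ _ hl.symm]
        simp
      · simp
    rw [blockCoord_apply]
    simp_rw [h, TensorProduct.tmul_smul, TensorProduct.smul_tmul', ← TensorProduct.sum_tmul]
    congr 1
    apply (ULift.moduleEquiv (R := ℂ)).injective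
    funext k
    rw [map_sum]
    simp only [map_smul, Finset.sum_apply, Pi.smul_apply, smul_eq_mul]
    change ∑ l, b.down l * (Pi.single l 1 : Fin (d i) → ℂ) k = b.down k
    simp [Pi.single_apply]

theorem blockCoord_blockMap_of_ne {i j : Fin r} (hij : i ≠ j)
    (y : standardSpace.{u} d i ⊗[ℂ] multiplicitySpace φ i) :
    blockCoord φ j (blockMap φ i y) = 0 := by
  induction y with
  | zero => simp
  | add y z hy hz => rw [map_add, map_add, hy, hz, add_zero]
  | tmul b a =>
    have h (k : Fin (d j)) : (⟨φ (matrixUnit j 0 k) (blockMap φ i (b ⊗ₜ a)),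
        apply_matrixUnit_mem φ j k _⟩ : multiplicitySpace φ j) = 0 := by
      ext
      simp only [blockMap_tmul, map_sum, map_smul, Submodule.coe_zero]
      refine Finset.sum_eq_zero fun l _ => ?_
      change _ • (φ _ * φ _) (a : U) = _
      rw [← map_mul, matrixUnit_mul_of_ne_block hij.symm]
      simp
    rw [blockCoord_apply]
    simp [h]

theorem apply_blockMap (M : ∀ i, Matrix (Fin (d i)) (Fin (d i)) ℂ) (i : Fin r)
    (f : Module.End ℂ (standardSpace.{u} d i))
    (hf : ∀ b, (f b).down = (M i).mulVec b.down)
    (y : standardSpace.{u} d i ⊗[ℂ] multiplicitySpace φ i) :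
    φ M (blockMap φ i y) = blockMap φ i (f.rTensor _ y) := by
  induction y with
  | zero => simp
  | add y z hy hz => simp only [map_add, hy, hz]
  | tmul b a =>
    rw [LinearMap.rTensor_tmul, blockMap_tmul, blockMap_tmul, hf]
    have h (k : Fin (d i)) : φ M (φ (matrixUnit i k 0) (a : U)) =
        ∑ l, M i l k • φ (matrixUnit i l 0) (a : U) := by
      change (φ _ * φ _) (a : U) = _
      rw [← map_mul, mul_matrixUnit]
      simp [LinearMap.sum_apply]
    simp only [map_sum, map_smul, h, Finset.smul_sum, Matrix.mulVec, dotProduct, Finset.sum_smul,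
      smul_smul]
    rw [Finset.sum_comm]
    simp only [mul_comm]

/-- The decomposition `U ≃ ⨁ i, B i ⊗ A i` given by an action of a product of matrix algebras. -/
def decompositionEquiv :
    U ≃ₗ[ℂ] ⨁ i, standardSpace.{u} d i ⊗[ℂ] multiplicitySpace φ i :=
  LinearEquiv.ofLinearMap
    (∑ i, DirectSum.lof ℂ _ (fun i => standardSpace.{u} d i ⊗[ℂ] multiplicitySpace φ i) i ∘ₗ
      blockCoord φ i)
    (DirectSum.toModule ℂ _ _ (blockMap φ))
    (by
      refine DirectSum.linearMap_ext _ fun i => LinearMap.ext fun y => ?_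
      simp only [LinearMap.comp_apply, DirectSum.toModule_lof, LinearMap.sum_apply,
        LinearMap.id_apply]
      rw [Finset.sum_eq_single i, blockCoord_blockMap_same]
      · intro j _ hj
        rw [blockCoord_blockMap_of_ne φ hj.symm, map_zero]
      · simp)
    (by
      ext x
      simp only [LinearMap.comp_apply, LinearMap.sum_apply, map_sum, DirectSum.toModule_lof,
        blockMap_blockCoord, LinearMap.id_apply]
      have h := LinearMap.congr_fun (congrArg φ (sum_matrixUnit (d := d))) x
      simpa [LinearMap.sum_apply] using h)

theorem decompositionEquiv_symm_lof (i : Fin r)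
    (y : standardSpace.{u} d i ⊗[ℂ] multiplicitySpace φ i) :
    (decompositionEquiv φ).symm (DirectSum.lof ℂ _ _ i y) = blockMap φ i y := by
  change DirectSum.toModule ℂ (Fin r) U (blockMap φ) _ = _
  exact DirectSum.toModule_lof ℂ (φ := blockMap φ) i y

/-- The tensor decomposition given by a faithful action of a product of matrix algebras. -/
def tensorDecomposition [FiniteDimensional ℂ U] (hφ : Function.Injective φ) :
    TensorDecomposition U where
  r := r
  B := standardSpace d
  A i := multiplicitySpace φ i
  finiteB i := Module.Finite.equiv ULift.moduleEquiv.symm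
  -- Faithfulness is what makes each multiplicity space nonzero.
  nontrivialA i := by
    rw [Submodule.nontrivial_iff_ne_bot, Ne, LinearMap.range_eq_bot, map_eq_zero_iff φ hφ]
    intro h
    simpa [matrixUnit] using congrFun (congrFun (congrFun h i) 0) 0
  equiv := decompositionEquiv φ

theorem tensorDecomposition_endHom [FiniteDimensional ℂ U] (hφ : Function.Injective φ)
    (M : ∀ i, Matrix (Fin (d i)) (Fin (d i)) ℂ)
    (f : ∀ i, Module.End ℂ (standardSpace.{u} d i))
    (hf : ∀ i b, (f i b).down = (M i).mulVec b.down) :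
    (tensorDecomposition φ hφ).endHom f = φ M := by
  have h : (decompositionEquiv φ).symm.toLinearMap ∘ₗ
      DirectSum.lmap (fun i => LinearMap.rTensor (multiplicitySpace φ i) (f i)) =
      φ M ∘ₗ (decompositionEquiv φ).symm.toLinearMap := by
    refine DirectSum.linearMap_ext _ fun i => LinearMap.ext fun y => ?_
    simp only [LinearMap.comp_apply, LinearEquiv.coe_coe, DirectSum.lmap_lof,
      decompositionEquiv_symm_lof]
    exact (apply_blockMap φ M i (f i) (hf i) y).symm
  ext x
  exact (LinearMap.congr_fun h (decompositionEquiv φ x)).trans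
    (congrArg (φ M) ((decompositionEquiv φ).symm_apply_apply x))

/-- A semisimple algebra of endomorphisms of a complex vector space `U` is `∏ i, End(B i)` for
a decomposition `U ≃ ⨁ i, B i ⊗ A i`. -/
theorem exists_tensorDecomposition_of_isSemisimpleRing [FiniteDimensional ℂ U]
    (A : Subalgebra ℂ (Module.End ℂ U)) [IsSemisimpleRing A] :
    ∃ D : TensorDecomposition U, Function.Injective D.endHom ∧
      Set.range D.endHom = (A : Set (Module.End ℂ U)) := by
  obtain ⟨r, d, _, ⟨e⟩⟩ := IsSemisimpleRing.exists_algEquiv_pi_matrix_of_isAlgClosed ℂ A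
  let φ := A.val.comp e.symm.toAlgHom
  have hφ : Function.Injective φ := Subtype.val_injective.comp e.symm.injective
  let τ (i : Fin r) : Matrix (Fin (d i)) (Fin (d i)) ℂ ≃ₗ[ℂ] Module.End ℂ (standardSpace.{_} d i) :=
    Matrix.toLin'.trans (LinearEquiv.conj ULift.moduleEquiv.symm)
  have hτ (f : ∀ i, Module.End ℂ (standardSpace d i)) :
      (tensorDecomposition φ hφ).endHom f = φ (fun i => (τ i).symm (f i)) := by
    refine tensorDecomposition_endHom φ hφ _ f fun i b => ?_
    obtain ⟨m, hm⟩ := (τ i).surjective (f i)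
    rw [← hm, LinearEquiv.symm_apply_apply]
    rfl
  refine ⟨tensorDecomposition φ hφ, fun f f' hff => ?_, ?_⟩
  · have := hφ ((hτ f).symm.trans (hff.trans (hτ f')))
    funext i
    exact (τ i).symm.injective (congrFun this i)
  · ext x
    constructor
    · rintro ⟨f, rfl⟩
      rw [hτ f]
      exact (e.symm _).2
    · intro hx
      refine ⟨fun i => τ i (e ⟨x, hx⟩ i), (hτ _).trans ?_⟩
      simp only [LinearEquiv.symm_apply_apply]
      exact congrArg Subtype.val (e.symm_apply_apply ⟨x, hx⟩)

end Decomposition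

/-- The algebra of endomorphisms commuting with a subgroup of `GL(U)`. -/
def commutant (H : Subgroup (GLin U)) : Subalgebra ℂ (Module.End ℂ U) :=
  Subalgebra.centralizer ℂ ((fun h : GLin U => (h : Module.End ℂ U)) '' H)

theorem mem_commutant_iff {H : Subgroup (GLin U)} {f : Module.End ℂ U} :
    f ∈ commutant H ↔ ∀ h ∈ H, (h : Module.End ℂ U) * f = f * h := by
  simp [commutant, Subalgebra.mem_centralizer_iff]

theorem coe_mem_commutant_iff {H : Subgroup (GLin U)} {g : GLin U} :
    (g : Module.End ℂ U) ∈ commutant H ↔ g ∈ Subgroup.centralizer (H : Set (GLin U)) := by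
  simp [mem_commutant_iff, Subgroup.mem_centralizer_iff, ← Units.val_mul, Units.val_inj]

/-- The inverse of an element of the centralizer lies in the commutant too, so its preimage under
the injective `D.endHom` inverts that of the element. -/
theorem centralizer_eq_range_glHom {H : Subgroup (GLin U)} {D : TensorDecomposition U}
    (hinj : Function.Injective D.endHom)
    (hD : Set.range D.endHom = (commutant H : Set (Module.End ℂ U))) :
    Subgroup.centralizer (H : Set (GLin U)) = D.glHom.range := by
  ext g
  rw [← coe_mem_commutant_iff, ← SetLike.mem_coe, ← hD]
  constructor
  · rintro ⟨f, hf⟩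
    have hg : ((g⁻¹ : GLin U) : Module.End ℂ U) ∈ Set.range D.endHom := by
      rw [hD, SetLike.mem_coe, coe_mem_commutant_iff]
      refine inv_mem (coe_mem_commutant_iff.1 ?_)
      rw [← SetLike.mem_coe, ← hD]
      exact ⟨f, hf⟩
    obtain ⟨f', hf'⟩ := hg
    refine ⟨MulEquiv.piUnits ⟨f, f', hinj ?_, hinj ?_⟩, ?_⟩
    · simp [hf, hf']
    · simp [hf, hf']
    · ext1
      simpa [TensorDecomposition.glHom] using hf
  · rintro ⟨b, rfl⟩
    exact ⟨_, rfl⟩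

theorem injective_glHom {D : TensorDecomposition U} (hinj : Function.Injective D.endHom) :
    Function.Injective D.glHom :=
  (Units.map_injective hinj).comp MulEquiv.piUnits.symm.injective

/-! ### The Jacobson radical of an algebra of endomorphisms. -/

section Radical

/-- The Jacobson radical of an algebra of endomorphisms, as a space of endomorphisms. -/
def radical (A : Subalgebra ℂ (Module.End ℂ U)) : Submodule ℂ (Module.End ℂ U) :=
  ((Ring.jacobson A).restrictScalars ℂ).map A.val.toLinearMap

variable {A : Subalgebra ℂ (Module.End ℂ U)}

theorem mem_radical_iff {f : Module.End ℂ U} :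
    f ∈ radical A ↔ ∃ h : f ∈ A, (⟨f, h⟩ : A) ∈ Ring.jacobson A := by
  simp [radical]

theorem mem_of_mem_radical {f : Module.End ℂ U} (hf : f ∈ radical A) : f ∈ A :=
  (mem_radical_iff.1 hf).1

theorem mul_mem_radical {a f : Module.End ℂ U} (ha : a ∈ A) (hf : f ∈ radical A) :
    a * f ∈ radical A := by
  obtain ⟨h, hf⟩ := mem_radical_iff.1 hf
  exact mem_radical_iff.2 ⟨mul_mem ha h, Ideal.mul_mem_left _ ⟨a, ha⟩ hf⟩

theorem isNilpotent_of_mem_radical [FiniteDimensional ℂ U] {f : Module.End ℂ U}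
    (hf : f ∈ radical A) : IsNilpotent f := by
  obtain ⟨h, hf⟩ := mem_radical_iff.1 hf
  have : IsArtinianRing A := IsArtinianRing.of_finite ℂ A
  obtain ⟨n, hn⟩ := IsSemiprimaryRing.isNilpotent (R := A)
  refine ⟨n, ?_⟩
  have := Ideal.pow_mem_pow hf n
  rw [hn] at this
  exact congrArg Subtype.val (show (⟨f, h⟩ : A) ^ n = 0 from this)

theorem isSemisimpleRing_of_radical_eq_bot [FiniteDimensional ℂ U] (h : radical A = ⊥) :
    IsSemisimpleRing A := by
  have : IsArtinianRing A := IsArtinianRing.of_finite ℂ A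
  rw [IsArtinianRing.isSemisimpleRing_iff_jacobson, eq_bot_iff]
  intro a ha
  have : (a : Module.End ℂ U) ∈ radical A := mem_radical_iff.2 ⟨a.2, ha⟩
  rw [h] at this
  exact Subtype.ext this

/-- Conjugation is a surjective ring endomorphism of `A`, and such maps send the Jacobson radical
into itself. -/
theorem conj_mem_radical {g : GLin U}
    (hg : ∀ a ∈ A, (g : Module.End ℂ U) * a * (g⁻¹ : GLin U) ∈ A)
    (hg' : ∀ a ∈ A, ((g⁻¹ : GLin U) : Module.End ℂ U) * a * g ∈ A) {f : Module.End ℂ U}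
    (hf : f ∈ radical A) : (g : Module.End ℂ U) * f * (g⁻¹ : GLin U) ∈ radical A := by
  obtain ⟨h, hf⟩ := mem_radical_iff.1 hf
  let σ : A →+* A :=
    { toFun a := ⟨g * a * (g⁻¹ : GLin U), hg a a.2⟩
      map_one' := by ext1; simp
      map_zero' := by ext1; simp
      map_add' a b := by ext1; simp [mul_add, add_mul]
      map_mul' a b := by ext1; simp [mul_assoc] }
  have : RingHomSurjective σ := ⟨fun a => ⟨⟨_, hg' a a.2⟩, by ext1; simp [σ, mul_assoc]⟩⟩
  exact mem_radical_iff.2 ⟨hg f h, Ring.le_comap_jacobson σ hf⟩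

end Radical

/-! ### The identity component is the centralizer. -/

section Component

variable {K L : Subgroup (PGLin U)}

theorem proj_commute (hKL : Subgroup.centralizer (L : Set (PGLin U)) = K) {g h : GLin U}
    (hg : g ∈ K.comap (proj U)) (hh : h ∈ L.comap (proj U)) : Commute (proj U g) (proj U h) := by
  rw [Subgroup.mem_comap, ← hKL, Subgroup.mem_centralizer_iff] at hg
  exact (hg _ hh).symm

theorem centralizer_comap_le (hKL : Subgroup.centralizer (L : Set (PGLin U)) = K) :
    Subgroup.centralizer (L.comap (proj U) : Set (GLin U)) ≤ K.comap (proj U) := by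
  intro g hg
  rw [Subgroup.mem_comap, ← hKL, Subgroup.mem_centralizer_iff]
  intro x hx
  obtain ⟨h, rfl⟩ := QuotientGroup.mk'_surjective _ x
  rw [← map_mul, ← map_mul, Subgroup.mem_centralizer_iff.1 hg h hx]

theorem isPreconnected_centralizer [FiniteDimensional ℂ U] (H : Subgroup (GLin U)) :
    @IsPreconnected (GLin U) (zariskiGL U) (Subgroup.centralizer (H : Set (GLin U))) := by
  have h := isPreconnected_of_line_mem (commutant H : Set (Module.End ℂ U)) fun a ha b hb t =>
    add_mem ha (Subalgebra.smul_mem _ (sub_mem hb ha) t)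
  convert h using 1
  ext g
  exact coe_mem_commutant_iff.symm

theorem identityComponent_eq_centralizer [FiniteDimensional ℂ U]
    (hKL : Subgroup.centralizer (L : Set (PGLin U)) = K) :
    identityComponent (K.comap (proj U)) =
      Subgroup.centralizer (L.comap (proj U) : Set (GLin U)) := by
  let := zariskiGL U
  refine Set.Subset.antisymm (fun g hg => ?_) ?_
  · rw [SetLike.mem_coe, Subgroup.mem_centralizer_iff]
    intro h hh
    -- For `U = 0` the condition `c ^ 0 = 1` would not bound the number of scalars.
    cases subsingleton_or_nontrivial U with
    | inl _ => exact Subsingleton.elim _ _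
    | inr _ =>
    let Z (c : ℂ) : Set (GLin U) :=
      {x | (x : Module.End ℂ U) * h = c • ((h : Module.End ℂ U) * x)}
    have hZ (c : ℂ) : IsClosed (Z c) := by
      convert isClosed_mem_submodule (LinearMap.ker (LinearMap.mulRight ℂ (h : Module.End ℂ U) -
        c • LinearMap.mulLeft ℂ (h : Module.End ℂ U))) using 1
      ext x
      simp [Z, sub_eq_zero]
    let s : Set ℂ := {c | c ^ Module.finrank ℂ U = 1}
    have hs : s.Finite := by
      refine (Polynomial.nthRoots (Module.finrank ℂ U) (1 : ℂ)).toFinset.finite_toSet.subset ?_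
      intro c hc
      rw [Finset.mem_coe, Multiset.mem_toFinset, Polynomial.mem_nthRoots Module.finrank_pos]
      exact hc
    have hconn : IsPreconnected (identityComponent (K.comap (proj U))) :=
      isPreconnected_connectedComponentIn
    have hsub : identityComponent (K.comap (proj U)) ⊆ K.comap (proj U) :=
      connectedComponentIn_subset _ _
    have hone : (1 : GLin U) ∈ identityComponent (K.comap (proj U)) :=
      mem_connectedComponentIn (one_mem _)
    by_contra hgh
    rw [isPreconnected_closed_iff] at hconn
    obtain ⟨x, -, hx1, hx⟩ := hconn (Z 1) (⋃ c ∈ s \ {1}, Z c) (hZ 1)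
      (hs.sdiff.isClosed_biUnion fun c _ => hZ c)
      (by
        intro x hx
        obtain ⟨c, hc, hxc⟩ := exists_mul_eq_smul_mul (proj_commute hKL (hsub hx) hh)
        by_cases hc1 : c = 1
        · subst hc1
          exact Or.inl hxc
        · exact Or.inr (Set.mem_biUnion (x := c) ⟨hc, hc1⟩ hxc))
      ⟨1, hone, by simp [Z]⟩
      (by
        obtain ⟨c, hc, hxc⟩ := exists_mul_eq_smul_mul (proj_commute hKL (hsub hg) hh)
        refine ⟨g, hg, Set.mem_biUnion (x := c) ⟨hc, ?_⟩ hxc⟩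
        rintro rfl
        refine hgh (Units.ext ?_)
        simpa using hxc.symm)
    -- A point of both closed sets satisfies `h x = c h x` with `h x ≠ 0`, contradicting `c ≠ 1`.
    obtain ⟨c, ⟨-, hc⟩, hxc⟩ := Set.mem_iUnion₂.1 hx
    have h0 : ((h * x : GLin U) : Module.End ℂ U) ≠ 0 := Units.ne_zero _
    have h1 : (1 : ℂ) • ((h : Module.End ℂ U) * x) = c • ((h : Module.End ℂ U) * x) :=
      hx1.symm.trans hxc
    exact hc (smul_left_injective ℂ h0 h1).symm
  · exact (isPreconnected_centralizer _).subset_connectedComponentIn (one_mem _)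
      (centralizer_comap_le hKL)

end Component

/-! ### Reductivity and semisimplicity of the commutant. -/

section Semisimple

variable {K L : Subgroup (PGLin U)}

/-- Moving `h` past `g` produces a scalar, which is absorbed again when `h` moves past `g⁻¹`. -/
theorem conj_mem_commutant [FiniteDimensional ℂ U] (hKL : Subgroup.centralizer (L : Set (PGLin U)) = K) {g : GLin U}
    (hg : g ∈ K.comap (proj U)) {a : Module.End ℂ U} (ha : a ∈ commutant (L.comap (proj U))) :
    (g : Module.End ℂ U) * a * (g⁻¹ : GLin U) ∈ commutant (L.comap (proj U)) := by
  rw [mem_commutant_iff] at ha ⊢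
  intro h hh
  obtain ⟨c, -, hc⟩ := exists_mul_eq_smul_mul (proj_commute hKL (inv_mem hg) hh)
  have h1 : (h : Module.End ℂ U) * g = c • ((g : Module.End ℂ U) * h) := by
    have := congrArg (fun f : Module.End ℂ U => (g : Module.End ℂ U) * f * g) hc
    simpa [mul_assoc] using this
  calc (h : Module.End ℂ U) * (g * a * (g⁻¹ : GLin U)) = h * g * a * (g⁻¹ : GLin U) := by
        simp only [mul_assoc]
    _ = c • ((g : Module.End ℂ U) * (h * a) * (g⁻¹ : GLin U)) := by
        simp only [h1, smul_mul_assoc, mul_assoc]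
    _ = c • ((g : Module.End ℂ U) * (a * h) * (g⁻¹ : GLin U)) := by rw [ha h hh]
    _ = (g : Module.End ℂ U) * a * (c • ((h : Module.End ℂ U) * (g⁻¹ : GLin U))) := by
        simp only [mul_smul_comm, mul_assoc]
    _ = (g : Module.End ℂ U) * a * (g⁻¹ : GLin U) * h := by
        rw [← hc]
        simp only [mul_assoc]

/-- The unipotent group `1 + J`, for `J` the Jacobson radical of the commutant of `H`. -/
def unipotentGroup (H : Subgroup (GLin U)) : Subgroup (GLin U) where
  carrier := {g | (g : Module.End ℂ U) - 1 ∈ radical (commutant H)}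
  one_mem' := by simp
  mul_mem' {g g'} hg hg' := by
    have h : ((g * g' : GLin U) : Module.End ℂ U) - 1 =
        ((g : Module.End ℂ U) - 1) * (g' - 1) + (g - 1) + (g' - 1) := by
      rw [Units.val_mul]
      noncomm_ring
    rw [Set.mem_ofPred_eq, h]
    exact add_mem (add_mem (mul_mem_radical (mem_of_mem_radical hg) hg') hg) hg'
  inv_mem' {g} hg := by
    have h : ((g⁻¹ : GLin U) : Module.End ℂ U) - 1 = -((g⁻¹ : GLin U) * ((g : Module.End ℂ U) - 1)) := by
      simp [mul_sub]
    rw [Set.mem_ofPred_eq, h]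
    refine neg_mem (mul_mem_radical ?_ hg)
    rw [coe_mem_commutant_iff]
    refine inv_mem (coe_mem_commutant_iff.1 ?_)
    simpa using add_mem (mem_of_mem_radical hg) (one_mem _)

theorem mem_unipotentGroup {H : Subgroup (GLin U)} {g : GLin U} :
    g ∈ unipotentGroup H ↔ (g : Module.End ℂ U) - 1 ∈ radical (commutant H) := Iff.rfl

theorem unipotentGroup_le_centralizer (H : Subgroup (GLin U)) :
    unipotentGroup H ≤ Subgroup.centralizer (H : Set (GLin U)) := fun g hg =>
  coe_mem_commutant_iff.1 (by simpa using add_mem (mem_of_mem_radical hg) (one_mem _))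

/-- The preimage in `GL(U)` is the set of invertible elements of the subspace `ℂ·1 + J`, which is
closed. -/
theorem isAlgebraic_map_unipotentGroup [FiniteDimensional ℂ U] (H : Subgroup (GLin U)) :
    IsAlgebraic ((unipotentGroup H).map (proj U)) := by
  let := zariskiGL U
  rw [IsAlgebraic, isClosed_coinduced]
  convert isClosed_mem_submodule (Submodule.span ℂ {1} ⊔ radical (commutant H)) using 1
  ext g
  simp only [Set.mem_preimage, SetLike.mem_coe, Subgroup.mem_map, Set.mem_ofPred_eq,
    Submodule.mem_sup, Submodule.mem_span_singleton]
  constructor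
  · rintro ⟨x, hx, hxg⟩
    obtain ⟨c, hc⟩ := exists_eq_smul_one_of_mem_center (QuotientGroup.eq.1 hxg)
    refine ⟨c • 1, ⟨c, rfl⟩, c • ((x : Module.End ℂ U) - 1), Submodule.smul_mem _ _ hx, ?_⟩
    have h := congrArg ((x : Module.End ℂ U) * ·) hc
    simp only [Units.val_mul, Units.mul_inv_cancel_left, mul_smul_comm, mul_one] at h
    rw [h, ← smul_add]
    congr 1
    abel
  · rintro ⟨_, ⟨c, rfl⟩, j, hj, hg⟩
    -- If `c = 0`, then `g` is both invertible and nilpotent, which forces `End(U) = 0`. Otherwise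
    -- dividing `g` by `c` lands in `1 + J`.
    by_cases hc : c = 0
    · have : IsNilpotent (g : Module.End ℂ U) := by
        rw [← hg, hc, zero_smul, zero_add]
        exact isNilpotent_of_mem_radical hj
      have h0 : Subsingleton (Module.End ℂ U) := by
        by_contra h
        rw [not_subsingleton_iff_nontrivial] at h
        exact this.not_isUnit g.isUnit
      refine ⟨1, one_mem _, ?_⟩
      congr 1
      exact Units.ext (Subsingleton.elim _ _)
    · let z : GLin U := ⟨c⁻¹ • 1, c • 1, by simp [hc], by simp [hc]⟩
      refine ⟨g * z, ?_, ?_⟩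
      · rw [mem_unipotentGroup]
        have : ((g * z : GLin U) : Module.End ℂ U) - 1 = c⁻¹ • j := by
          simp [z, ← hg, smul_smul, hc]
        rw [this]
        exact Submodule.smul_mem _ _ hj
      · refine (QuotientGroup.mk_mul_of_mem g (mem_center_of_eq_smul_one (c := c⁻¹) rfl))

theorem isConnected_map_unipotentGroup [FiniteDimensional ℂ U] (H : Subgroup (GLin U)) :
    @IsConnected (PGLin U) (zariskiPGL U) ((unipotentGroup H).map (proj U) : Set (PGLin U)) := by
  let := zariskiGL U
  let := zariskiPGL U
  refine ⟨⟨1, one_mem _⟩, ?_⟩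
  rw [Subgroup.coe_map]
  refine IsPreconnected.image ?_ _ continuous_coinduced_rng.continuousOn
  refine isPreconnected_of_line_mem {f | f - 1 ∈ radical (commutant H)} fun a ha b hb t => ?_
  have h : a + t • (b - a) - 1 = (a - 1) + t • ((b - 1) - (a - 1)) := by
    rw [sub_sub_sub_cancel_right]
    abel
  rw [Set.mem_ofPred_eq, h]
  exact add_mem ha (Submodule.smul_mem _ _ (sub_mem hb ha))

theorem isSemisimpleRing_commutant [FiniteDimensional ℂ U] (hK : IsReductive K)
    (hKL : Subgroup.centralizer (L : Set (PGLin U)) = K) :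
    IsSemisimpleRing (commutant (L.comap (proj U))) := by
  set H := L.comap (proj U)
  have hN : (unipotentGroup H).map (proj U) = ⊥ := by
    have hle : (unipotentGroup H).map (proj U) ≤ K :=
      Subgroup.map_le_iff_le_comap.2 ((unipotentGroup_le_centralizer H).trans
        (centralizer_comap_le hKL))
    refine hK.2 _ hle ⟨?_⟩ (isAlgebraic_map_unipotentGroup H) (isConnected_map_unipotentGroup H) ?_
    · rintro ⟨_, hx⟩ ⟨g, hg, rfl⟩ ⟨y, hy⟩
      obtain ⟨k, rfl⟩ := QuotientGroup.mk'_surjective _ y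
      refine ⟨k * g * k⁻¹, ?_, by simp⟩
      have h : ((k * g * k⁻¹ : GLin U) : Module.End ℂ U) - 1 =
          k * ((g : Module.End ℂ U) - 1) * (k⁻¹ : GLin U) := by
        simp [mul_sub, sub_mul]
      rw [SetLike.mem_coe, mem_unipotentGroup, h]
      refine conj_mem_radical (fun a => conj_mem_commutant hKL hy) (fun a ha => ?_) hg
      simpa using conj_mem_commutant hKL (inv_mem (show k ∈ K.comap (proj U) from hy)) ha
    · rintro _ ⟨g, hg, rfl⟩
      exact ⟨g, isNilpotent_of_mem_radical hg, rfl⟩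
  refine isSemisimpleRing_of_radical_eq_bot (eq_bot_iff.2 fun j hj => ?_)
  cases subsingleton_or_nontrivial U with
  | inl _ => exact Subsingleton.elim _ _
  | inr _ =>
  have hnil := isNilpotent_of_mem_radical hj
  -- The unit `1 + j` has trivial image in `PGL(U)`, so `j` is a scalar; being nilpotent, it is
  -- zero.
  obtain ⟨g, hg⟩ := hnil.isUnit_add_one
  have hgN : g ∈ unipotentGroup H := by
    rw [mem_unipotentGroup, hg, add_sub_cancel_right]
    exact hj
  have hgc : g ∈ Subgroup.center (GLin U) := by
    rw [← QuotientGroup.eq_one_iff, ← Subgroup.mem_bot, ← hN]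
    exact ⟨g, hgN, rfl⟩
  obtain ⟨c, hc⟩ := exists_eq_smul_one_of_mem_center hgc
  have hj' : j = algebraMap ℂ (Module.End ℂ U) (c - 1) := by
    rw [map_sub, Algebra.algebraMap_eq_smul_one, ← hc, hg, map_one, add_sub_cancel_right]
  rw [hj', IsNilpotent.map_iff (FaithfulSMul.algebraMap_injective _ _)] at hnil
  rw [Submodule.mem_bot, hj', hnil.eq_zero, map_zero]

end Semisimple

theorem exists_tensorDecomposition_centralizer [FiniteDimensional ℂ U] {K L : Subgroup (PGLin U)}
    (hK : IsReductive K) (hKL : Subgroup.centralizer (L : Set (PGLin U)) = K) :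
    ∃ D : TensorDecomposition U, Function.Injective D.glHom ∧
      Subgroup.centralizer (L.comap (proj U) : Set (GLin U)) = D.glHom.range := by
  have := isSemisimpleRing_commutant hK hKL
  obtain ⟨D, hinj, hD⟩ :=
    exists_tensorDecomposition_of_isSemisimpleRing (commutant (L.comap (proj U)))
  exact ⟨D, injective_glHom hinj, centralizer_eq_range_glHom hinj hD⟩

end DualPair

end

theorem mainTheorem5 {U : Type*} [AddCommGroup U] [Module ℂ U] [FiniteDimensional ℂ U]
    (Gbar Hbar : Subgroup (DualPair.PGLin U)) (hpair : DualPair.IsReductiveDualPair Gbar Hbar)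
    (G H : Subgroup (DualPair.GLin U))
    (hG : G = Gbar.comap (DualPair.proj U)) (hH : H = Hbar.comap (DualPair.proj U)) :
    (DualPair.identityComponent G = Subgroup.centralizer (H : Set (DualPair.GLin U)) ∧
      ∃ D : DualPair.TensorDecomposition U,
        Function.Injective D.glHom ∧
          Subgroup.centralizer (H : Set (DualPair.GLin U)) = D.glHom.range) ∧
    (DualPair.identityComponent H = Subgroup.centralizer (G : Set (DualPair.GLin U)) ∧
      ∃ D : DualPair.TensorDecomposition U,
        Function.Injective D.glHom ∧
          Subgroup.centralizer (G : Set (DualPair.GLin U)) = D.glHom.range) := by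
  subst hG hH
  exact ⟨⟨DualPair.identityComponent_eq_centralizer hpair.centralizer_right,
      DualPair.exists_tensorDecomposition_centralizer hpair.reductive_left
        hpair.centralizer_right⟩,
    ⟨DualPair.identityComponent_eq_centralizer hpair.centralizer_left,
      DualPair.exists_tensorDecomposition_centralizer hpair.reductive_right
        hpair.centralizer_left⟩⟩
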